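/- **Double gamma function.** For $\tau>0$ let $\psi=\Gamma'/\Gamma$, let $\gamma$ be the Euler–Mascheroni constant, and put $$C(\tau)=\lim_{M\to\infty}\Big[\sum_{k=1}^{M-1}\psi(k\tau)+\tfrac12\psi(M\tau)-\tfrac1\tau\log\tfrac{\Gamma(M\tau)}{\sqrt{2\pi}}\Big],\qquad D(\tau)=\lim_{M\to\infty}\Big[\sum_{k=1}^{M-1}\psi'(k\tau)+\tfrac12\psi'(M\tau)-\tfrac1\tau\psi(M\tau)\Big],$$ $$a(\tau)=\gamma\tau+\tfrac\tau2\log(2\pi\tau)+\tfrac12\log\tau-\tau C(\tau),\qquad b(\tau)=-\tfrac{\pi^2\tau^2}{6}-\tau\log\tau-\tau^2D(\tau),$$ $$G(z;\tau)=\frac z\tau\exp\Big[a(\tau)\frac z\tau+b(\tau)\frac{z^2}{2\tau^2}\Big]\prod_{(k,l)\in\mathbb N^2\setminus\{(0,0)\}}\Big(1+\frac z{k\tau+l}\Big)\exp\Big(-\frac z{k\tau+l}+\frac{z^2}{2(k\tau+l)^2}\Big),$$ where $\mathbb N=\{0,1,2,\dots\}$. **Fox–Barnes $I$-function.** Let $0\le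 m\le q$, $0\le n\le p$, $\tau>0$, $\varepsilon\in\mathbb C$, $a_i,b_i\in\mathbb C$, $\alpha_i,\beta_i>0$. Put $$I^{m,n}_{p,q}\Big[z;\tau,\varepsilon\,\Big|\,\begin{matrix}(a_i,\alpha_i)_{1,p}\\(b_i,\beta_i)_{1,q}\end{matrix}\Big]=\frac1{2\pi i}\int_{\mathcal C}\frac{\prod_{i=1}^mG(b_i+\beta_is;\tau)\prod_{i=1}^nG(1+\tau-a_i-\alpha_is;\tau)}{\prod_{i=m+1}^qG(1+\tau-b_i-\beta_is;\tau)\prod_{i=n+1}^pG(a_i+\alpha_is;\tau)}\,e^{\pi\varepsilon s^2/\tau}z^{-s}\,ds .$$ Here $z\neq0$ is a point of the Riemann surface of the logarithm and $z^{-s}=e^{-s\log z}$. The contour $\mathcal C$ is a simple piecewise $C^1$ curve, going to infinity at both ends, of one of the following kinds: $\mathcal C_{ic\infty}$, from $c-i\infty$ to $c+i\infty$ ($c\in\mathbb R$); $\mathcal C_{(\theta_-,\theta_+)}$, starting with a half-line of direction $\theta_-\in(-\pi,0)$ and ending with one of direction $\theta_+\in(0,\pi)$; a left loop $\mathcal C_{-\infty}$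 in a horizontal strip from $-\infty+i\varphi_1$ to $-\infty+i\varphi_2$, or a right loop $\mathcal C_{+\infty}$ in a horizontal strip from $+\infty+i\varphi_2$ to $+\infty+i\varphi_1$ ($\varphi_1<0<\varphi_2$). All points $-(a_j+k\tau+l)/\alpha_j$ ($j>n$, $k,l\ge0$) lie in the component of the complement of $\mathcal C$ containing the real numbers near $-\infty$, and all points $(-b_i+k\tau+l)/\beta_i$ ($i>m$, $k,l\ge1$) lie in the component containing the real numbers near $+\infty$. Convergence of the integral means absolute convergence. **Proposition.** For $c_i$ indexed as the $b_i$ and $d_i$ indexed as the $a_i$ write $S(c,d)=\sum_{i=1}^mc_i+\sum_{i=1}^nd_i-\sum_{i=m+1}^qc_i-\sum_{i=n+1}^pd_i$, and put $$\Delta_k=S(\beta^k,\alpha^k),\quad D_k=S(b^k,a^k),\quad\Pi=S(b\beta,a\alpha),\quad\mathcal N=2(m+n)-(p+q),$$ $$\delta^*=\sum_{i=1}^qb_i-\sum_{i=1}^pa_i,\qquad\Delta^*=\sum_{i=1}^q\beta_i-\sum_{i=1}^p\alpha_i,$$ $$A=(2\pi)^{\frac{\tau-1}{2\tau}[\delta^*+(1+\tau)(m+n-q)]}\,\tau^{\frac1{2\tau}[(1+\tau)D_1-D_2]-\mathcal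 N},\qquad B=(2\pi)^{\frac{\tau-1}{2\tau}\Delta^*}\,\tau^{\frac1{2\tau}[(1+\tau)\Delta_1-2\Pi]},$$ with $\log B=\frac{\tau-1}{2\tau}\Delta^*\log 2\pi+\frac1{2\tau}[(1+\tau)\Delta_1-2\Pi]\log\tau$. If $\mathcal C$ is a contour for the parameters $(a_i,\alpha_i),(b_i,\beta_i),\tau$, then $\tau^{-1}\mathcal C$ is a contour, of the corresponding kind (with $c$ or $\varphi_1,\varphi_2$ divided by $\tau$ and $\theta_\pm$ unchanged), for the parameters $(\tau^{-1}a_i,\alpha_i),(\tau^{-1}b_i,\beta_i),\tau^{-1}$. For every $z$, the $I$-function on the left below, taken along $\mathcal C$, converges if and only if the one on the right, taken along $\tau^{-1}\mathcal C$, does, and $$I^{m,n}_{p,q}\Big[z;\tau,\varepsilon\,\Big|\,\begin{matrix}(a_i,\alpha_i)_{1,p}\\(b_i,\beta_i)_{1,q}\end{matrix}\Big]=A\,\tau\;I^{m,n}_{p,q}\Big[(z/B)^\tau;\tau^{-1},\varepsilon-\frac{\Delta_2\log\tau}{2\pi}\,\Big|\,\begin{matrix}(\tau^{-1}a_i,\alpha_i)_{1,p}\\(\tau^{-1}b_i,\beta_i)_{1,q}\end{matrix}\Big],$$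 where $\log\big((z/B)^\tau\big)=\tau(\log z-\log B)$. In particular the identity holds with principal values of the logarithm and of the powers for every complex $z\ne0$ such that $\arg z-\operatorname{Im}\log B$ and $\tau(\arg z-\operatorname{Im}\log B)$ lie in $(-\pi,\pi]$, where $\arg z$ is the principal argument. -/

import Mathlib

open Filter Topology MeasureTheory

noncomputable section

namespace FoxBarnes

/-! ### The double gamma function -/

/-- The digamma function on the real line. -/
def psi (x : ℝ) : ℝ := logDeriv Real.Gamma x

/-- The constant `C(τ)`. -/
def constC (τ : ℝ) : ℝ :=
  limUnder atTop (fun M : ℕ =>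
    ∑ k ∈ Finset.Ico 1 M, psi (k * τ) + (1 / 2) * psi (M * τ)
      - (1 / τ) * Real.log (Real.Gamma (M * τ) / Real.sqrt (2 * Real.pi)))

/-- The constant `D(τ)`. -/
def constD (τ : ℝ) : ℝ :=
  limUnder atTop (fun M : ℕ =>
    ∑ k ∈ Finset.Ico 1 M, deriv psi (k * τ) + (1 / 2) * deriv psi (M * τ)
      - (1 / τ) * psi (M * τ))

/-- The constant `a(τ)` of the double gamma function. -/
def constA (τ : ℝ) : ℝ :=
  Real.eulerMascheroniConstant * τ + (τ / 2) * Real.log (2 * Real.pi * τ)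
    + (1 / 2) * Real.log τ - τ * constC τ

/-- The constant `b(τ)` of the double gamma function. -/
def constB (τ : ℝ) : ℝ :=
  -(Real.pi ^ 2 * τ ^ 2 / 6) - τ * Real.log τ - τ ^ 2 * constD τ

/-- The Barnes double gamma function `G(z; τ)`, by its Weierstrass product over the pairs
`k = (m, n)` of natural numbers other than `(0, 0)`. -/
def doubleGamma (z : ℂ) (τ : ℝ) : ℂ :=
  z / τ * Complex.exp (constA τ * z / τ + constB τ * z ^ 2 / (2 * τ ^ 2)) *
    ∏' k : {k : ℕ × ℕ // k ≠ (0, 0)},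
      ((1 + z / (k.1.1 * τ + k.1.2)) *
        Complex.exp (-(z / (k.1.1 * τ + k.1.2)) + z ^ 2 / (2 * (k.1.1 * τ + k.1.2) ^ 2)))

/-! ### The integrand

The upper parameters are `(a i, α i)`, `i : Fin p`, the lower ones `(b i, β i)`, `i : Fin q`;
indices start from `0`, so the first `n` upper ones are those with `i.val < n` and the first `m`
lower ones those with `i.val < m`. -/

/-- The quotient of products of double gamma functions. -/
def kernel (m n : ℕ) {p q : ℕ} (a : Fin p → ℂ) (α : Fin p → ℝ) (b : Fin q → ℂ) (β : Fin q → ℝ)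
    (τ : ℝ) (s : ℂ) : ℂ :=
  ((∏ i : Fin q with i.val < m, doubleGamma (b i + β i * s) τ) *
      ∏ i : Fin p with i.val < n, doubleGamma (1 + τ - a i - α i * s) τ) /
    ((∏ i : Fin q with m ≤ i.val, doubleGamma (1 + τ - b i - β i * s) τ) *
      ∏ i : Fin p with n ≤ i.val, doubleGamma (a i + α i * s) τ)

/-- The full integrand at the point `z` of the Riemann surface of the logarithm whose logarithm
is `ℓ`; the power `z ^ (-s)` is `exp (-s ℓ)`. -/
def integrand (m n : ℕ) {p q : ℕ} (a : Fin p → ℂ) (α : Fin p → ℝ) (b : Fin q → ℂ)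
    (β : Fin q → ℝ) (τ : ℝ) (ε : ℂ) (ℓ : ℂ) (s : ℂ) : ℂ :=
  kernel m n a α b β τ s * Complex.exp (Real.pi * ε * s ^ 2 / τ) * Complex.exp (-s * ℓ)

/-! ### Contours -/

/-- The poles that a contour leaves to the left, coming from the zeros of `G(a i + α i s; τ)`. -/
def leftPoles (n : ℕ) {p : ℕ} (a : Fin p → ℂ) (α : Fin p → ℝ) (τ : ℝ) : Set ℂ :=
  {s | ∃ i : Fin p, n ≤ i.val ∧ ∃ k l : ℕ, s = -(a i + k * τ + l) / α i}

/-- The poles that a contour leaves to the right, coming from the zeros of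
`G(1 + τ - b i - β i s; τ)`. -/
def rightPoles (m : ℕ) {q : ℕ} (b : Fin q → ℂ) (β : Fin q → ℝ) (τ : ℝ) : Set ℂ :=
  {s | ∃ i : Fin q, m ≤ i.val ∧ ∃ k l : ℕ, 1 ≤ k ∧ 1 ≤ l ∧ s = (-b i + k * τ + l) / β i}

/-- The kinds of contours. -/
inductive ContourKind where
  /-- from `c - i∞` to `c + i∞` -/
  | vertical (c : ℝ)
  /-- from a half-line of direction `θ₁` in the lower half-plane to one of direction `θ₂` in the
  upper half-plane -/
  | sector (θ₁ θ₂ : ℝ)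
  /-- a left loop in a horizontal strip, from `-∞ + i φ₁` to `-∞ + i φ₂` -/
  | leftLoop (φ₁ φ₂ : ℝ)
  /-- a right loop in a horizontal strip, from `+∞ + i φ₂` to `+∞ + i φ₁` -/
  | rightLoop (φ₁ φ₂ : ℝ)

/-- The kind of the dilated contour `r 𝒞`, `r > 0`. -/
def ContourKind.dilate (r : ℝ) : ContourKind → ContourKind
  | .vertical c => .vertical (r * c)
  | .sector θ₁ θ₂ => .sector θ₁ θ₂
  | .leftLoop φ₁ φ₂ => .leftLoop (r * φ₁) (r * φ₂)
  | .rightLoop φ₁ φ₂ => .rightLoop (r * φ₁) (r * φ₂)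

/-- `γ` has the ends that its kind prescribes. -/
def ContourKind.HasEnds (γ : ℝ → ℂ) : ContourKind → Prop
  | .vertical c =>
      Tendsto (fun t => (γ t).re) atBot (𝓝 c) ∧ Tendsto (fun t => (γ t).im) atBot atBot ∧
      Tendsto (fun t => (γ t).re) atTop (𝓝 c) ∧ Tendsto (fun t => (γ t).im) atTop atTop
  | .sector θ₁ θ₂ =>
      (-Real.pi < θ₁ ∧ θ₁ < 0 ∧ 0 < θ₂ ∧ θ₂ < Real.pi) ∧
      (∃ s₁ : ℂ, ∀ᶠ t in atBot, ∃ r : ℝ, 0 ≤ r ∧ γ t = s₁ + r * Complex.exp (θ₁ * Complex.I)) ∧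
      (∃ s₂ : ℂ, ∀ᶠ t in atTop, ∃ r : ℝ, 0 ≤ r ∧ γ t = s₂ + r * Complex.exp (θ₂ * Complex.I))
  | .leftLoop φ₁ φ₂ =>
      (φ₁ < 0 ∧ 0 < φ₂) ∧ (∃ h : ℝ, ∀ t, |(γ t).im| ≤ h) ∧
      Tendsto (fun t => (γ t).re) atBot atBot ∧ Tendsto (fun t => (γ t).im) atBot (𝓝 φ₁) ∧
      Tendsto (fun t => (γ t).re) atTop atBot ∧ Tendsto (fun t => (γ t).im) atTop (𝓝 φ₂)
  | .rightLoop φ₁ φ₂ =>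
      (φ₁ < 0 ∧ 0 < φ₂) ∧ (∃ h : ℝ, ∀ t, |(γ t).im| ≤ h) ∧
      Tendsto (fun t => (γ t).re) atBot atTop ∧ Tendsto (fun t => (γ t).im) atBot (𝓝 φ₂) ∧
      Tendsto (fun t => (γ t).re) atTop atTop ∧ Tendsto (fun t => (γ t).im) atTop (𝓝 φ₁)

/-- The point `s` lies in the component of the complement of `γ` that contains the real points
near `-∞`. -/
def LeftOf (γ : ℝ → ℂ) (s : ℂ) : Prop :=
  ∀ᶠ R : ℝ in atTop, JoinedIn (Set.range γ)ᶜ s (((-R : ℝ) : ℂ))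

/-- The point `s` lies in the component of the complement of `γ` that contains the real points
near `+∞`. -/
def RightOf (γ : ℝ → ℂ) (s : ℂ) : Prop :=
  ∀ᶠ R : ℝ in atTop, JoinedIn (Set.range γ)ᶜ s ((R : ℂ))

/-- `γ` is a contour of integration of kind `κ` for the given parameters: a simple, piecewise
continuously differentiable curve going to infinity in both directions, with the ends prescribed
by `κ`, that separates the two families of poles. -/
structure IsContour (m n : ℕ) {p q : ℕ} (a : Fin p → ℂ) (α : Fin p → ℝ) (b : Fin q → ℂ)
    (β : Fin q → ℝ) (τ : ℝ) (κ : ContourKind) (γ : ℝ → ℂ) : Prop where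
  injective : Function.Injective γ
  locallyLipschitz : LocallyLipschitz γ
  piecewise : ∃ S : Set ℝ, S.Finite ∧ ∀ t, t ∉ S → ContDiffAt ℝ 1 γ t
  tendsto_atBot : Tendsto γ atBot (cocompact ℂ)
  tendsto_atTop : Tendsto γ atTop (cocompact ℂ)
  ends : κ.HasEnds γ
  left : ∀ s ∈ leftPoles n a α τ, LeftOf γ s
  right : ∀ s ∈ rightPoles m b β τ, RightOf γ s

/-! ### The Fox-Barnes `I`-function -/

/-- The contour integral defining the `I`-function converges (absolutely). -/
def Converges (m n : ℕ) {p q : ℕ} (a : Fin p → ℂ) (α : Fin p → ℝ) (b : Fin q → ℂ)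
    (β : Fin q → ℝ) (τ : ℝ) (ε : ℂ) (γ : ℝ → ℂ) (ℓ : ℂ) : Prop :=
  Integrable (fun t : ℝ => integrand m n a α b β τ ε ℓ (γ t) * deriv γ t)

/-- The Fox-Barnes `I`-function, defined with the contour `γ`, at the point `z` of the Riemann
surface of the logarithm with `log z = ℓ`. -/
def foxBarnesI (m n : ℕ) {p q : ℕ} (a : Fin p → ℂ) (α : Fin p → ℝ) (b : Fin q → ℂ)
    (β : Fin q → ℝ) (τ : ℝ) (ε : ℂ) (γ : ℝ → ℂ) (ℓ : ℂ) : ℂ :=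
  1 / (2 * Real.pi * Complex.I) * ∫ t : ℝ, integrand m n a α b β τ ε ℓ (γ t) * deriv γ t

/-! ### The constants of the transformation -/

/-- `∑_{i ≤ m} g i + ∑_{i ≤ n} f i - ∑_{m < i ≤ q} g i - ∑_{n < i ≤ p} f i`. -/
def signedSum (m n : ℕ) {p q : ℕ} (f : Fin p → ℂ) (g : Fin q → ℂ) : ℂ :=
  (∑ i : Fin q with i.val < m, g i) + (∑ i : Fin p with i.val < n, f i)
    - (∑ i : Fin q with m ≤ i.val, g i) - ∑ i : Fin p with n ≤ i.val, f i

/-- `Δ_k`. -/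
def Delta (k m n : ℕ) {p q : ℕ} (α : Fin p → ℝ) (β : Fin q → ℝ) : ℂ :=
  signedSum m n (fun i => (α i : ℂ) ^ k) (fun i => (β i : ℂ) ^ k)

/-- `D_k`. -/
def Dsum (k m n : ℕ) {p q : ℕ} (a : Fin p → ℂ) (b : Fin q → ℂ) : ℂ :=
  signedSum m n (fun i => a i ^ k) (fun i => b i ^ k)

/-- `Π`. -/
def PiSum (m n : ℕ) {p q : ℕ} (a : Fin p → ℂ) (α : Fin p → ℝ) (b : Fin q → ℂ)
    (β : Fin q → ℝ) : ℂ :=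
  signedSum m n (fun i => a i * α i) (fun i => b i * β i)

/-- `δ*`. -/
def deltaStar {p q : ℕ} (a : Fin p → ℂ) (b : Fin q → ℂ) : ℂ := ∑ i, b i - ∑ i, a i

/-- `Δ*`. -/
def DeltaStar {p q : ℕ} (α : Fin p → ℝ) (β : Fin q → ℝ) : ℂ := ∑ i, (β i : ℂ) - ∑ i, (α i : ℂ)

/-- `𝒩 = 2(m + n) - (p + q)`. -/
def Ncal (m n p q : ℕ) : ℂ := 2 * ((m : ℂ) + n) - ((p : ℂ) + q)

/-- The factor `A`. -/
def factorA (m n : ℕ) {p q : ℕ} (a : Fin p → ℂ) (b : Fin q → ℂ) (τ : ℝ) : ℂ :=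
  ((2 * Real.pi : ℝ) : ℂ) ^
      (((τ : ℂ) - 1) / (2 * τ) * (deltaStar a b + (1 + τ) * ((m : ℂ) + n - q))) *
    (τ : ℂ) ^
      (1 / (2 * (τ : ℂ)) * ((1 + τ) * Dsum 1 m n a b - Dsum 2 m n a b) - Ncal m n p q)

/-- The exponent of `2π` in `B`. -/
def expB₁ {p q : ℕ} (α : Fin p → ℝ) (β : Fin q → ℝ) (τ : ℝ) : ℂ :=
  ((τ : ℂ) - 1) / (2 * τ) * DeltaStar α β

/-- The exponent of `τ` in `B`. -/
def expB₂ (m n : ℕ) {p q : ℕ} (a : Fin p → ℂ) (α : Fin p → ℝ) (b : Fin q → ℂ) (β : Fin q → ℝ)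
    (τ : ℝ) : ℂ :=
  1 / (2 * (τ : ℂ)) * ((1 + τ) * Delta 1 m n α β - 2 * PiSum m n a α b β)

/-- The factor `B`. -/
def factorB (m n : ℕ) {p q : ℕ} (a : Fin p → ℂ) (α : Fin p → ℝ) (b : Fin q → ℂ) (β : Fin q → ℝ)
    (τ : ℝ) : ℂ :=
  ((2 * Real.pi : ℝ) : ℂ) ^ expB₁ α β τ * (τ : ℂ) ^ expB₂ m n a α b β τ

/-- The logarithm of `B` given by the real logarithms of the positive bases `2π` and `τ`. -/
def logB (m n : ℕ) {p q : ℕ} (a : Fin p → ℂ) (α : Fin p → ℝ) (b : Fin q → ℂ) (β : Fin q → ℝ)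
    (τ : ℝ) : ℂ :=
  expB₁ α β τ * (Real.log (2 * Real.pi) : ℝ) + expB₂ m n a α b β τ * (Real.log τ : ℝ)

theorem exp_logB (m n : ℕ) {p q : ℕ} (a : Fin p → ℂ) (α : Fin p → ℝ) (b : Fin q → ℂ)
    (β : Fin q → ℝ) {τ : ℝ} (hτ : 0 < τ) :
    Complex.exp (logB m n a α b β τ) = factorB m n a α b β τ := by
  have h1 : ((2 * Real.pi : ℝ) : ℂ) ≠ 0 := by exact_mod_cast Real.two_pi_pos.ne'
  have h2 : (τ : ℂ) ≠ 0 := by exact_mod_cast hτ.ne'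
  rw [factorB, logB, Complex.cpow_def_of_ne_zero h1, Complex.cpow_def_of_ne_zero h2,
    ← Complex.exp_add, Complex.ofReal_log Real.two_pi_pos.le, Complex.ofReal_log hτ.le]
  congr 1
  ring

end FoxBarnes

end

noncomputable section

namespace FoxBarnes

/-! ### The digamma function on the positive half-line -/

/-! Everything follows from one reflection law, `doubleGamma_inv`: `G(z; τ)` is `G(z/τ; 1/τ)` times
the exponential of a quadratic polynomial in `z`. The Weierstrass product is itself invariant, since
exchanging `k` and `l` turns `kτ + l` into `τ` times the lattice point for `1/τ`. The law thus
reduces to comparing the constants at `τ` and `1/τ`, that is, to `constC_inv` and `constD_inv`.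

For these, the recurrences of `ψ` and `ψ'` move each argument `kτ` to `N + kτ`. The correction is a
sum over an `N` by `N` square of lattice points, symmetric up to scaling, which cancels between `τ`
and `1/τ`. The moved sums are trapezoidal sums on `[N, N(1 + τ)]`; monotonicity of `ψ'` makes their
error vanish, and Stirling's formula and `ψ(x) - log x → 0` evaluate what remains.

Multiplying the law over all factors of the integrand gives a quadratic exponent in `s`
(`kernelExponent_eq`): its constant term is `log A`, its linear term is absorbed in `log B`, its
quadratic term in `ε`. Dilating the curve then makes the two integrands proportional pointwise, so
convergence and the identity follow together. -/

theorem analyticAt_realGamma {x : ℝ} (hx : 0 < x) : AnalyticAt ℝ Real.Gamma x := by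
  have h : AnalyticAt ℂ Complex.Gamma (x : ℂ) := by
    refine DifferentiableOn.analyticAt (s := {z : ℂ | 0 < z.re}) (fun z hz => ?_) ?_
    · refine (Complex.differentiableAt_Gamma z fun m h => ?_).differentiableWithinAt
      have hz' : 0 < z.re := hz
      rw [h] at hz'
      simp only [Complex.neg_re, Complex.natCast_re] at hz'
      have : (0 : ℝ) ≤ m := m.cast_nonneg
      linarith
    · exact (isOpen_lt continuous_const Complex.continuous_re).mem_nhds (by simpa using hx)
  exact h.re_ofReal

theorem analyticAt_psi {x : ℝ} (hx : 0 < x) : AnalyticAt ℝ psi x :=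
  (analyticAt_realGamma hx).deriv.div (analyticAt_realGamma hx) (Real.Gamma_pos_of_pos hx).ne'

theorem hasDerivAt_psi {x : ℝ} (hx : 0 < x) : HasDerivAt psi (deriv psi x) x :=
  (analyticAt_psi hx).differentiableAt.hasDerivAt

/-- The logarithm of the Gamma function on the real line. -/
def logGamma (x : ℝ) : ℝ := Real.log (Real.Gamma x)

theorem hasDerivAt_logGamma {x : ℝ} (hx : 0 < x) : HasDerivAt logGamma (psi x) x :=
  (analyticAt_realGamma hx).differentiableAt.hasDerivAt.log (Real.Gamma_pos_of_pos hx).ne'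

theorem logGamma_add_one {x : ℝ} (hx : 0 < x) : logGamma (x + 1) = logGamma x + Real.log x := by
  rw [logGamma, Real.Gamma_add_one hx.ne', Real.log_mul hx.ne' (Real.Gamma_pos_of_pos hx).ne',
    logGamma, add_comm]

theorem convexOn_logGamma : ConvexOn ℝ (Set.Ioi 0) logGamma := Real.convexOn_log_Gamma

theorem psi_add_one {x : ℝ} (hx : 0 < x) : psi (x + 1) = psi x + 1 / x := by
  have h1 : HasDerivAt (fun y => logGamma (y + 1)) (psi (x + 1)) x := by
    simpa using (hasDerivAt_logGamma (by linarith : 0 < x + 1)).comp_add_const x 1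
  have h2 : HasDerivAt (fun y => logGamma y + Real.log y) (psi x + 1 / x) x :=
    ((hasDerivAt_logGamma hx).add (Real.hasDerivAt_log hx.ne')).congr_deriv (by simp)
  refine h1.unique (h2.congr_of_eventuallyEq ?_)
  filter_upwards [lt_mem_nhds hx] with y hy using logGamma_add_one hy

theorem deriv_psi_add_one {x : ℝ} (hx : 0 < x) :
    deriv psi (x + 1) = deriv psi x - 1 / x ^ 2 := by
  have h1 : HasDerivAt (fun y => psi (y + 1)) (deriv psi (x + 1)) x := by
    simpa using (hasDerivAt_psi (by linarith : 0 < x + 1)).comp_add_const x 1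
  have h2 : HasDerivAt (fun y => psi y + y⁻¹) (deriv psi x - 1 / x ^ 2) x :=
    ((hasDerivAt_psi hx).add (hasDerivAt_inv hx.ne')).congr_deriv (by simp [sub_eq_add_neg])
  refine h1.unique (h2.congr_of_eventuallyEq ?_)
  filter_upwards [lt_mem_nhds hx] with y hy
  rw [psi_add_one hy, one_div]

theorem psi_add_nat {x : ℝ} (hx : 0 < x) (N : ℕ) :
    psi (x + N) = psi x + ∑ l ∈ Finset.range N, 1 / (x + l) := by
  induction N with
  | zero => simp
  | succ N ih =>
    rw [Finset.sum_range_succ, Nat.cast_succ, ← add_assoc, psi_add_one (by positivity), ih]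
    ring

theorem deriv_psi_add_nat {x : ℝ} (hx : 0 < x) (N : ℕ) :
    deriv psi (x + N) = deriv psi x - ∑ l ∈ Finset.range N, 1 / (x + l) ^ 2 := by
  induction N with
  | zero => simp
  | succ N ih =>
    rw [Finset.sum_range_succ, Nat.cast_succ, ← add_assoc, deriv_psi_add_one (by positivity), ih]
    ring

/-- The slope of `log Γ` over `[x, x + 1]` is exactly `log x` by the functional equation, and
convexity compares it with the derivative at the left end. The right end gives the companion lower
bound. -/
theorem psi_le_log {x : ℝ} (hx : 0 < x) : psi x ≤ Real.log x := by
  have h := convexOn_logGamma.deriv_le_slope (x := x) (y := x + 1) hx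
    (by simp only [Set.mem_Ioi]; linarith) (by linarith) (hasDerivAt_logGamma hx).differentiableAt
  rw [(hasDerivAt_logGamma hx).deriv, slope_def_field, logGamma_add_one hx] at h
  simpa using h

theorem log_le_psi_add {x : ℝ} (hx : 0 < x) : Real.log x ≤ psi x + 1 / x := by
  have hx1 : 0 < x + 1 := by linarith
  have h := convexOn_logGamma.slope_le_deriv (x := x) (y := x + 1) hx hx1
    (by linarith) (hasDerivAt_logGamma hx1).differentiableAt
  rw [(hasDerivAt_logGamma hx1).deriv, slope_def_field, logGamma_add_one hx, psi_add_one hx] at h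
  simpa using h

theorem tendsto_psi_sub_log : Tendsto (fun x => psi x - Real.log x) atTop (𝓝 0) := by
  have h : Tendsto (fun x : ℝ => -(1 / x)) atTop (𝓝 0) := by
    simpa using (tendsto_inv_atTop_zero (𝕜 := ℝ)).neg
  refine tendsto_of_tendsto_of_tendsto_of_le_of_le' h tendsto_const_nhds ?_ ?_
  · filter_upwards [eventually_gt_atTop 0] with x hx
    linarith [log_le_psi_add hx]
  · filter_upwards [eventually_gt_atTop 0] with x hx
    linarith [psi_le_log hx]

theorem tendsto_log_natCast_add_sub_log (x : ℝ) :
    Tendsto (fun N : ℕ => Real.log (x + N) - Real.log N) atTop (𝓝 0) := by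
  have h : Tendsto (fun N : ℕ => x / N + 1) atTop (𝓝 1) := by
    simpa using (tendsto_const_div_atTop_nhds_zero_nat x).add_const 1
  have h2 := (Real.continuousAt_log one_ne_zero).tendsto.comp h
  rw [Real.log_one] at h2
  have h3 : Tendsto (fun N : ℕ => x + (N : ℝ)) atTop atTop :=
    tendsto_atTop_add_const_left _ _ tendsto_natCast_atTop_atTop
  refine h2.congr' ?_
  filter_upwards [eventually_gt_atTop 0, h3.eventually_gt_atTop 0] with N hN hxN
  have hN' : (0 : ℝ) < N := by exact_mod_cast hN
  rw [← Real.log_div hxN.ne' hN'.ne', add_div, div_self hN'.ne']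
  rfl

theorem tendsto_log_sub_sum {x : ℝ} (hx : 0 < x) :
    Tendsto (fun N : ℕ => Real.log N - ∑ l ∈ Finset.range N, 1 / (x + l)) atTop (𝓝 (psi x)) := by
  have h1 : Tendsto (fun N : ℕ => x + (N : ℝ)) atTop atTop :=
    tendsto_atTop_add_const_left _ _ tendsto_natCast_atTop_atTop
  have h2 := (tendsto_psi_sub_log.comp h1).add (tendsto_log_natCast_add_sub_log x)
  have h3 := h2.const_sub (psi x)
  simp only [add_zero, sub_zero] at h3
  refine h3.congr fun N => ?_
  simp only [Function.comp_apply, psi_add_nat hx]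
  ring

/-- Each approximant `log N - ∑ 1 / (x + l)` is concave because `1 / (x + l)` is convex, and
concavity passes to pointwise limits. Its purpose is the monotonicity of `ψ'`, which controls both
trapezoidal estimates. -/
theorem concaveOn_psi : ConcaveOn ℝ (Set.Ioi 0) psi := by
  refine ⟨convex_Ioi 0, fun x hx y hy s t hs ht hst => ?_⟩
  have hx : 0 < x := hx
  have hy : 0 < y := hy
  have hz : 0 < s • x + t • y := convex_Ioi (0 : ℝ) hx hy hs ht hst
  refine le_of_tendsto_of_tendsto' (((tendsto_log_sub_sum hx).const_smul s).add
    ((tendsto_log_sub_sum hy).const_smul t)) (tendsto_log_sub_sum hz) fun N => ?_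
  simp only [smul_eq_mul] at hz ⊢
  have key : ∑ l ∈ Finset.range N, 1 / (s * x + t * y + l) ≤
      s * ∑ l ∈ Finset.range N, 1 / (x + l) + t * ∑ l ∈ Finset.range N, 1 / (y + l) := by
    rw [Finset.mul_sum, Finset.mul_sum, ← Finset.sum_add_distrib]
    refine Finset.sum_le_sum fun l _ => ?_
    have h := (convexOn_zpow (𝕜 := ℝ) (-1)).2 (x := x + l) (y := y + l)
      (by simp only [Set.mem_Ioi]; positivity) (by simp only [Set.mem_Ioi]; positivity) hs ht hst
    simp only [smul_eq_mul, zpow_neg_one, ← one_div] at h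
    refine le_trans (le_of_eq ?_) h
    congr 1
    linear_combination (-(l : ℝ)) * hst
  have h3 : s * Real.log N + t * Real.log N = Real.log N := by rw [← add_mul, hst, one_mul]
  linarith

theorem antitoneOn_deriv_psi : AntitoneOn (deriv psi) (Set.Ioi 0) :=
  concaveOn_psi.antitoneOn_deriv fun _ hx => (hasDerivAt_psi hx).differentiableAt

theorem deriv_psi_nonneg {x : ℝ} (hx : 0 < x) : 0 ≤ deriv psi x := by
  have hx1 : 0 < x + 1 := by linarith
  have h := concaveOn_psi.slope_le_deriv (x := x) (y := x + 1) hx hx1 (by linarith)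
    (hasDerivAt_psi hx).differentiableAt
  rw [slope_def_field, psi_add_one hx] at h
  have : 0 < 1 / x := by positivity
  refine le_trans ?_ h
  simp [hx.le]

theorem deriv_psi_add_one_le {x : ℝ} (hx : 0 < x) : deriv psi (x + 1) ≤ 1 / x := by
  have hx1 : 0 < x + 1 := by linarith
  have h := concaveOn_psi.deriv_le_slope (x := x) (y := x + 1) hx hx1 (by linarith)
    (hasDerivAt_psi hx1).differentiableAt
  rw [slope_def_field, psi_add_one hx] at h
  simpa using h

theorem tendsto_deriv_psi : Tendsto (deriv psi) atTop (𝓝 0) := by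
  have h : Tendsto (fun x : ℝ => 1 / (x - 1)) atTop (𝓝 0) := by
    simpa [Function.comp_def, ← sub_eq_add_neg] using (tendsto_inv_atTop_zero (𝕜 := ℝ)).comp
      (tendsto_atTop_add_const_right atTop (-1 : ℝ) tendsto_id)
  refine tendsto_of_tendsto_of_tendsto_of_le_of_le' tendsto_const_nhds h ?_ ?_
  · filter_upwards [eventually_gt_atTop 0] with x hx using deriv_psi_nonneg hx
  · filter_upwards [eventually_gt_atTop 1] with x hx
    simpa using deriv_psi_add_one_le (sub_pos.2 hx)

/-! ### Stirling's formula for the real Gamma function -/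

/-- The remainder of Stirling's formula. -/
def stirlingRemainder (x : ℝ) : ℝ := logGamma x - (x - 1 / 2) * Real.log x + x

theorem hasDerivAt_stirlingRemainder {x : ℝ} (hx : 0 < x) :
    HasDerivAt stirlingRemainder (psi x - Real.log x + 1 / (2 * x)) x := by
  have h := ((hasDerivAt_logGamma hx).sub
    (((hasDerivAt_id x).sub_const (1 / 2)).mul (Real.hasDerivAt_log hx.ne'))).add (hasDerivAt_id x)
  refine h.congr_deriv ?_
  simp only [id]
  field_simp
  ring

theorem tendsto_stirlingRemainder_nat :
    Tendsto (fun n : ℕ => stirlingRemainder n) atTop (𝓝 (1 / 2 * Real.log (2 * Real.pi))) := by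
  have h := (Real.continuousAt_log (Real.sqrt_pos.2 Real.pi_pos).ne').tendsto.comp
    Stirling.tendsto_stirlingSeq_sqrt_pi
  have h2 := h.add_const (1 / 2 * Real.log 2)
  have e : Real.log √Real.pi + 1 / 2 * Real.log 2 = 1 / 2 * Real.log (2 * Real.pi) := by
    rw [Real.log_sqrt Real.pi_pos.le, Real.log_mul two_ne_zero Real.pi_pos.ne']
    ring
  rw [e] at h2
  refine h2.congr' ?_
  filter_upwards [eventually_gt_atTop 0] with n hn
  have hn' : (0 : ℝ) < n := by exact_mod_cast hn
  have hG : Real.log n.factorial = logGamma n + Real.log n := by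
    rw [← logGamma_add_one hn', logGamma, Real.Gamma_nat_eq_factorial]
  simp only [Function.comp_apply, Stirling.log_stirlingSeq_formula, stirlingRemainder, hG]
  rw [Real.log_mul two_ne_zero hn'.ne', Real.log_div hn'.ne' (Real.exp_pos 1).ne', Real.log_exp]
  ring

/-- **Stirling's formula** for the Gamma function on the positive half-line. -/
theorem tendsto_stirlingRemainder :
    Tendsto stirlingRemainder atTop (𝓝 (1 / 2 * Real.log (2 * Real.pi))) := by
  have h1 := tendsto_stirlingRemainder_nat.comp (tendsto_nat_floor_atTop (α := ℝ))
  have hfl : Tendsto (fun x : ℝ => ((⌊x⌋₊ : ℕ) : ℝ)) atTop atTop :=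
    tendsto_natCast_atTop_atTop.comp tendsto_nat_floor_atTop
  -- The bounds `log y - 1/y ≤ ψ(y) ≤ log y` put the derivative of the remainder in `[-1/(2y),
  -- 1/(2y)]`, so moving from `⌊x⌋` to `x` changes it by at most `1/⌊x⌋`. This carries the limit
  -- from the integers to the reals.
  have h2 : Tendsto (fun x : ℝ => stirlingRemainder x - stirlingRemainder ⌊x⌋₊) atTop (𝓝 0) := by
    refine squeeze_zero_norm' ?_ (tendsto_inv_atTop_zero.comp hfl)
    filter_upwards [eventually_ge_atTop 1] with x hx
    have hf : (0 : ℝ) < ⌊x⌋₊ := by exact_mod_cast Nat.floor_pos.2 hx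
    have hle : (⌊x⌋₊ : ℝ) ≤ x := Nat.floor_le (by linarith)
    have hlt : x < ⌊x⌋₊ + 1 := Nat.lt_floor_add_one x
    have h := Convex.norm_image_sub_le_of_norm_hasDerivWithin_le
      (f := stirlingRemainder) (s := Set.Icc (⌊x⌋₊ : ℝ) x) (C := (⌊x⌋₊ : ℝ)⁻¹)
      (fun y hy => (hasDerivAt_stirlingRemainder (hf.trans_le hy.1)).hasDerivWithinAt)
      (fun y hy => ?_) (convex_Icc _ _) ⟨le_rfl, hle⟩ ⟨hle, le_rfl⟩
    · refine h.trans ?_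
      rw [Function.comp_apply]
      refine mul_le_of_le_one_right (by positivity) ?_
      rw [Real.norm_eq_abs, abs_le]
      constructor <;> linarith
    · have hy0 : 0 < y := hf.trans_le hy.1
      have h3 : y⁻¹ ≤ (⌊x⌋₊ : ℝ)⁻¹ := inv_anti₀ hf hy.1
      have h4 := psi_le_log hy0
      have h5 := log_le_psi_add hy0
      have h6 : 1 / (2 * y) = y⁻¹ / 2 := by field_simp
      have h7 : 0 < y⁻¹ := by positivity
      rw [one_div] at h5
      rw [Real.norm_eq_abs, abs_le, h6]
      constructor <;> linarith
  simpa using h2.add h1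

/-! ### The trapezoidal rule -/

/-- The trapezoidal sum of `f` with `n` steps of length `h` from `x` on. -/
def trapezoid (f : ℝ → ℝ) (x h : ℝ) (n : ℕ) : ℝ :=
  ∑ k ∈ Finset.range n, (f (x + k * h) + f (x + (k + 1) * h)) / 2

theorem trapezoid_eq (f : ℝ → ℝ) (x h : ℝ) {n : ℕ} (hn : 1 ≤ n) :
    trapezoid f x h n =
      ∑ k ∈ Finset.Ico 1 n, f (x + k * h) + f x / 2 + f (x + n * h) / 2 := by
  induction n, hn using Nat.le_induction with
  | base => simp [trapezoid]; ring
  | succ n hn ih =>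
    rw [Finset.sum_Ico_succ_top hn]
    rw [trapezoid] at ih ⊢
    rw [Finset.sum_range_succ, ih]
    push_cast
    ring

/-- Bounds for single steps add up to one for the trapezoidal sum. -/
theorem abs_trapezoid_sub_le {f F v : ℝ → ℝ} {h : ℝ} (hh : 0 < h)
    (H : ∀ x, 0 < x → |h * ((f x + f (x + h)) / 2) - (F (x + h) - F x)| ≤ v x - v (x + h))
    {x : ℝ} (hx : 0 < x) (n : ℕ) :
    |h * trapezoid f x h n - (F (x + n * h) - F x)| ≤ v x - v (x + n * h) := by
  induction n with
  | zero => simp [trapezoid]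
  | succ n ih =>
    have h1 := H (x + n * h) (by positivity)
    have e : x + n * h + h = x + (n + 1) * h := by ring
    rw [e] at h1
    rw [trapezoid] at ih ⊢
    rw [Finset.sum_range_succ, mul_add]
    push_cast
    rw [abs_le] at *
    constructor <;> linarith [h1.1, h1.2, ih.1, ih.2]

/-- By the mean value theorem the increment of `F` is `h * f c`, and `f c` lies between the two end
values of `f`. The bound is written as a difference so that it telescopes over successive steps. -/
theorem trapezoid_step_of_antitone {f F : ℝ → ℝ} (hF : ∀ x, 0 < x → HasDerivAt F (f x) x)
    (hf : AntitoneOn f (Set.Ioi 0)) {h : ℝ} (hh : 0 < h) {x : ℝ} (hx : 0 < x) :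
    |h * ((f x + f (x + h)) / 2) - (F (x + h) - F x)| ≤ h / 2 * f x - h / 2 * f (x + h) := by
  obtain ⟨c, hc, e⟩ := exists_hasDerivAt_eq_slope F f (a := x) (b := x + h) (by linarith)
    (fun y hy => (hF y (hx.trans_le hy.1)).continuousAt.continuousWithinAt)
    (fun y hy => hF y (hx.trans hy.1))
  have e' : F (x + h) - F x = h * f c := by
    rw [e, add_sub_cancel_left]
    field_simp
  have hc0 : 0 < c := hx.trans hc.1
  have hxh : 0 < x + h := by linarith
  have h1 : f c ≤ f x := hf hx hc0 hc.1.le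
  have h2 : f (x + h) ≤ f c := hf hc0 hxh hc.2.le
  rw [e', abs_le]
  constructor <;> nlinarith

theorem trapezoid_step_of_deriv_antitone {f g F : ℝ → ℝ} (hF : ∀ x, 0 < x → HasDerivAt F (f x) x)
    (hf : ∀ x, 0 < x → HasDerivAt f (g x) x)
    (hg : AntitoneOn g (Set.Ioi 0)) {h : ℝ} (hh : 0 < h) {x : ℝ} (hx : 0 < x) :
    |h * ((f x + f (x + h)) / 2) - (F (x + h) - F x)| ≤
      h ^ 2 / 2 * g x - h ^ 2 / 2 * g (x + h) := by
  have hxh : 0 < x + h := by linarith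
  -- The increment of this auxiliary function over `[x, x + h]` is the error of the step. A second
  -- mean value theorem, for `f` on `[x, c]`, turns its derivative at `c` into `(c - x) * (g c - g
  -- d) / 2` with `d < c`.
  have hd : ∀ y, x ≤ y → HasDerivAt (fun y => (y - x) * ((f x + f y) / 2) - F y)
      ((f x - f y) / 2 + (y - x) * (g y / 2)) y := fun y hy => by
    have hy0 : 0 < y := hx.trans_le hy
    refine ((((hasDerivAt_id y).sub_const x).mul
      (((hf y hy0).const_add (f x)).div_const 2)).sub (hF y hy0)).congr_deriv ?_
    simp only [id]
    ring
  obtain ⟨c, hc, e⟩ := exists_hasDerivAt_eq_slope _ _ (a := x) (b := x + h) (by linarith)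
    (fun y hy => (hd y hy.1).continuousAt.continuousWithinAt) (fun y hy => hd y hy.1.le)
  have hc0 : 0 < c := hx.trans hc.1
  obtain ⟨d, hd', e2⟩ := exists_hasDerivAt_eq_slope f g (a := x) (b := c) hc.1
    (fun y hy => (hf y (hx.trans_le hy.1)).continuousAt.continuousWithinAt)
    (fun y hy => hf y (hx.trans hy.1))
  have hd0 : 0 < d := hx.trans hd'.1
  have hcx : 0 < c - x := sub_pos.2 hc.1
  have e3 : f c - f x = (c - x) * g d := by
    rw [e2]
    field_simp
  have e4 : h * ((f x + f (x + h)) / 2) - (F (x + h) - F x) =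
      h * ((c - x) * ((g c - g d) / 2)) := by
    have : (f x - f c) / 2 + (c - x) * (g c / 2) = (c - x) * ((g c - g d) / 2) := by
      linear_combination (-1 / 2) * e3
    rw [← this, e, add_sub_cancel_left]
    field_simp
    ring
  have h1 : g d ≤ g x := hg hx hd0 hd'.1.le
  have h2 : g (x + h) ≤ g c := hg hc0 hxh hc.2.le
  have h3 : g c ≤ g d := hg hd0 hc0 hd'.2.le
  have hch : c - x ≤ h := by linarith [hc.2]
  have h4 : (c - x) * (g d - g c) ≤ h * (g x - g (x + h)) :=
    mul_le_mul hch (by linarith) (by linarith) hh.le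
  have h5 : 0 ≤ (c - x) * (g d - g c) := mul_nonneg hcx.le (by linarith)
  rw [e4, abs_le]
  constructor <;> nlinarith [mul_le_mul_of_nonneg_left h4 hh.le, mul_nonneg hh.le h5]

/-! ### Reflection of the constants under `τ ↦ 1 / τ` -/

/-- Consecutive terms differ by `1 / h` times the error of one trapezoidal step. These errors have a
telescoping majorant, bounded because `v ≥ 0`, so the sequence is Cauchy. -/
theorem exists_tendsto_sum_sub {f F v : ℝ → ℝ} {h : ℝ} (hh : 0 < h)
    (H : ∀ x, 0 < x → |h * ((f x + f (x + h)) / 2) - (F (x + h) - F x)| ≤ v x - v (x + h))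
    (hv : ∀ x, 0 < x → 0 ≤ v x) :
    ∃ l, Tendsto (fun M : ℕ => ∑ k ∈ Finset.Ico 1 M, f (k * h) + (1 / 2) * f (M * h)
      - (1 / h) * F (M * h)) atTop (𝓝 l) := by
  have hstep : ∀ n : ℕ, |h * ((f ((n + 1) * h) + f ((n + 2) * h)) / 2) -
      (F ((n + 2) * h) - F ((n + 1) * h))| ≤ v ((n + 1) * h) - v ((n + 2) * h) := fun n => by
    have h1 := H ((n + 1) * h) (by positivity)
    have e : ((n : ℝ) + 1) * h + h = (n + 2) * h := by ring
    rwa [e] at h1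
  have hsum : Summable fun n : ℕ => (1 / h) * (v ((n + 1) * h) - v ((n + 2) * h)) := by
    refine Summable.mul_left _ (summable_of_sum_range_le (c := v h)
      (fun n => (abs_nonneg _).trans (hstep n)) fun n => ?_)
    have e : ∀ m : ℕ, ∑ i ∈ Finset.range m, (v ((i + 1) * h) - v ((i + 2) * h)) =
        v h - v ((m + 1) * h) := fun m => by
      induction m with
      | zero => simp
      | succ m ih => rw [Finset.sum_range_succ, ih]; push_cast; ring_nf
    rw [e]
    have := hv ((n + 1) * h) (by positivity)
    linarith
  -- The sequence is started at `M = 1`: the step from `M = 0` would involve `f` and `F` at `0`,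
  -- where no bound is available.
  have hc : CauchySeq (fun n : ℕ => ∑ k ∈ Finset.Ico 1 (n + 1), f (k * h)
      + (1 / 2) * f ((n + 1 : ℕ) * h) - (1 / h) * F ((n + 1 : ℕ) * h)) := by
    refine cauchySeq_of_dist_le_of_summable _ (fun n => ?_) hsum
    rw [dist_comm, Real.dist_eq, Nat.succ_eq_add_one, Finset.sum_Ico_succ_top (by omega)]
    refine le_trans (le_of_eq ?_) (mul_le_mul_of_nonneg_left (hstep n) (by positivity))
    rw [← abs_of_pos (a := 1 / h) (by positivity), ← abs_mul,
      abs_of_pos (a := 1 / h) (by positivity)]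
    congr 1
    push_cast
    have e : (n : ℝ) + 1 + 1 = n + 2 := by ring
    rw [e]
    field_simp
    ring_nf
  obtain ⟨l, hl⟩ := cauchySeq_tendsto_of_complete hc
  exact ⟨l, (tendsto_add_atTop_iff_nat 1).1 hl⟩

theorem trapezoid_step_psi {h : ℝ} (hh : 0 < h) {x : ℝ} (hx : 0 < x) :
    |h * ((psi x + psi (x + h)) / 2) - (logGamma (x + h) - logGamma x)| ≤
      h ^ 2 / 2 * deriv psi x - h ^ 2 / 2 * deriv psi (x + h) :=
  trapezoid_step_of_deriv_antitone (fun _ => hasDerivAt_logGamma) (fun _ => hasDerivAt_psi)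
    antitoneOn_deriv_psi hh hx

theorem trapezoid_step_deriv_psi {h : ℝ} (hh : 0 < h) {x : ℝ} (hx : 0 < x) :
    |h * ((deriv psi x + deriv psi (x + h)) / 2) - (psi (x + h) - psi x)| ≤
      h / 2 * deriv psi x - h / 2 * deriv psi (x + h) :=
  trapezoid_step_of_antitone (fun _ => hasDerivAt_psi) antitoneOn_deriv_psi hh hx

/-- The sequence whose limit is `C(τ)`. -/
def seqC (τ : ℝ) (M : ℕ) : ℝ :=
  ∑ k ∈ Finset.Ico 1 M, psi (k * τ) + (1 / 2) * psi (M * τ)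
    - (1 / τ) * Real.log (Real.Gamma (M * τ) / Real.sqrt (2 * Real.pi))

/-- The sequence whose limit is `D(τ)`. -/
def seqD (τ : ℝ) (M : ℕ) : ℝ :=
  ∑ k ∈ Finset.Ico 1 M, deriv psi (k * τ) + (1 / 2) * deriv psi (M * τ)
    - (1 / τ) * psi (M * τ)

/-! ### Convergence of the sequences defining `C(τ)` and `D(τ)`. -/

theorem log_sqrt_two_pi : Real.log √(2 * Real.pi) = 1 / 2 * Real.log (2 * Real.pi) := by
  rw [Real.log_sqrt Real.two_pi_pos.le]
  ring

theorem seqC_eq {τ : ℝ} (hτ : 0 < τ) {M : ℕ} (hM : 0 < M) :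
    seqC τ M = ∑ k ∈ Finset.Ico 1 M, psi (k * τ) + (1 / 2) * psi (M * τ)
      - (1 / τ) * logGamma (M * τ) + (1 / τ) * (1 / 2 * Real.log (2 * Real.pi)) := by
  have hM' : (0 : ℝ) < M := by exact_mod_cast hM
  rw [seqC, Real.log_div (Real.Gamma_pos_of_pos (by positivity)).ne'
    (Real.sqrt_pos.2 Real.two_pi_pos).ne', log_sqrt_two_pi, logGamma]
  ring

theorem tendsto_seqC {τ : ℝ} (hτ : 0 < τ) : Tendsto (seqC τ) atTop (𝓝 (constC τ)) := by
  obtain ⟨l, hl⟩ := exists_tendsto_sum_sub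
    (f := psi) (F := logGamma) (v := fun x => τ ^ 2 / 2 * deriv psi x) hτ
    (fun x hx => trapezoid_step_psi hτ hx)
    (fun x hx => mul_nonneg (by positivity) (deriv_psi_nonneg hx))
  refine tendsto_nhds_limUnder ⟨l + (1 / τ) * (1 / 2 * Real.log (2 * Real.pi)), ?_⟩
  refine (hl.add_const _).congr' ?_
  filter_upwards [eventually_gt_atTop 0] with M hM using (seqC_eq hτ hM).symm

theorem tendsto_seqD {τ : ℝ} (hτ : 0 < τ) : Tendsto (seqD τ) atTop (𝓝 (constD τ)) :=
  tendsto_nhds_limUnder (exists_tendsto_sum_sub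
    (f := deriv psi) (F := psi) (v := fun x => τ / 2 * deriv psi x) hτ
    (fun x hx => trapezoid_step_deriv_psi hτ hx)
    (fun x hx => mul_nonneg (by positivity) (deriv_psi_nonneg hx)))

/-- The sum of `(k τ + l) ^ (-j)` over the positive integers `k, l < N`. -/
def latticeSum (j : ℕ) (τ : ℝ) (N : ℕ) : ℝ :=
  ∑ k ∈ Finset.Ico 1 N, ∑ l ∈ Finset.Ico 1 N, 1 / ((k : ℝ) * τ + l) ^ j

/-- Exchange `k` and `l` and use `l / τ + k = (kτ + l) / τ`. This symmetry is what eliminates the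
lattice sums from the reflection formulas. -/
theorem latticeSum_inv (j : ℕ) {τ : ℝ} (hτ : 0 < τ) (N : ℕ) :
    latticeSum j τ⁻¹ N = τ ^ j * latticeSum j τ N := by
  rw [latticeSum, latticeSum, Finset.sum_comm, Finset.mul_sum]
  refine Finset.sum_congr rfl fun k _ => ?_
  rw [Finset.mul_sum]
  refine Finset.sum_congr rfl fun l _ => ?_
  have e : (l : ℝ) * τ⁻¹ + k = (k * τ + l) / τ := by
    field_simp
    ring
  rw [e, div_pow, one_div_div]
  ring

/-- The recurrences of `ψ` and `ψ'` produce the range `0 ≤ l < N`. Splitting off `l = 0` leaves a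
square symmetric in `k` and `l`; the split terms later yield `γ` for `j = 1` and `π² / 6` for `j =
2`. -/
theorem sum_sum_range_eq_latticeSum (j : ℕ) (τ : ℝ) (N : ℕ) :
    ∑ k ∈ Finset.Ico 1 N, ∑ l ∈ Finset.range N, 1 / ((k : ℝ) * τ + l) ^ j =
      (1 / τ ^ j) * ∑ k ∈ Finset.Ico 1 N, 1 / (k : ℝ) ^ j + latticeSum j τ N := by
  rw [latticeSum, Finset.mul_sum, ← Finset.sum_add_distrib]
  refine Finset.sum_congr rfl fun k hk => ?_
  have hN : 0 < N := by
    have := Finset.mem_Ico.1 hk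
    omega
  rw [Finset.range_eq_Ico, Finset.sum_eq_sum_Ico_succ_bot hN]
  simp [mul_pow]

theorem sum_psi_mul {τ : ℝ} (hτ : 0 < τ) (N : ℕ) :
    ∑ k ∈ Finset.Ico 1 N, psi (k * τ) = ∑ k ∈ Finset.Ico 1 N, psi (N + k * τ)
      - (1 / τ) * ∑ k ∈ Finset.Ico 1 N, 1 / (k : ℝ) - latticeSum 1 τ N := by
  have h := sum_sum_range_eq_latticeSum 1 τ N
  simp only [pow_one] at h
  rw [sub_sub, ← h, ← Finset.sum_sub_distrib]
  refine Finset.sum_congr rfl fun k hk => ?_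
  have hk' : (0 : ℝ) < k := by exact_mod_cast (Finset.mem_Ico.1 hk).1
  rw [add_comm (N : ℝ), psi_add_nat (by positivity)]
  ring

theorem sum_deriv_psi_mul {τ : ℝ} (hτ : 0 < τ) (N : ℕ) :
    ∑ k ∈ Finset.Ico 1 N, deriv psi (k * τ) = ∑ k ∈ Finset.Ico 1 N, deriv psi (N + k * τ)
      + (1 / τ ^ 2) * ∑ k ∈ Finset.Ico 1 N, 1 / (k : ℝ) ^ 2 + latticeSum 2 τ N := by
  rw [add_assoc, ← sum_sum_range_eq_latticeSum 2 τ N, ← Finset.sum_add_distrib]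
  refine Finset.sum_congr rfl fun k hk => ?_
  have hk' : (0 : ℝ) < k := by exact_mod_cast (Finset.mem_Ico.1 hk).1
  rw [add_comm (N : ℝ), deriv_psi_add_nat (by positivity)]
  ring

/-! ### Asymptotics of the shifted sums and reflection of `C` and `D`. -/

theorem tendsto_natCast_mul {c : ℝ} (hc : 0 < c) :
    Tendsto (fun N : ℕ => (N : ℝ) * c) atTop atTop :=
  tendsto_natCast_atTop_atTop.atTop_mul_const hc

theorem tendsto_trapezoid_psi {τ : ℝ} (hτ : 0 < τ) :
    Tendsto (fun N : ℕ => τ * trapezoid psi N τ N - (logGamma (N * (1 + τ)) - logGamma N))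
      atTop (𝓝 0) := by
  have h0 : Tendsto (fun N : ℕ => τ ^ 2 / 2 * deriv psi N) atTop (𝓝 0) := by
    simpa using (tendsto_deriv_psi.comp tendsto_natCast_atTop_atTop).const_mul (τ ^ 2 / 2)
  refine squeeze_zero_norm' ?_ h0
  filter_upwards [eventually_gt_atTop 0] with N hN
  have hN' : (0 : ℝ) < N := by exact_mod_cast hN
  have h := abs_trapezoid_sub_le
    (f := psi) (F := logGamma) (v := fun x => τ ^ 2 / 2 * deriv psi x) hτ
    (fun x hx => trapezoid_step_psi hτ hx) hN' N
  have e : (N : ℝ) + N * τ = N * (1 + τ) := by ring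
  rw [e] at h
  have h1 := deriv_psi_nonneg (x := N * (1 + τ)) (by positivity)
  have h2 : 0 ≤ τ ^ 2 / 2 * deriv psi (N * (1 + τ)) := by positivity
  rw [Real.norm_eq_abs]
  linarith

theorem tendsto_trapezoid_deriv_psi {τ : ℝ} (hτ : 0 < τ) :
    Tendsto (fun N : ℕ => τ * trapezoid (deriv psi) N τ N - (psi (N * (1 + τ)) - psi N))
      atTop (𝓝 0) := by
  have h0 : Tendsto (fun N : ℕ => τ / 2 * deriv psi N) atTop (𝓝 0) := by
    simpa using (tendsto_deriv_psi.comp tendsto_natCast_atTop_atTop).const_mul (τ / 2)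
  refine squeeze_zero_norm' ?_ h0
  filter_upwards [eventually_gt_atTop 0] with N hN
  have hN' : (0 : ℝ) < N := by exact_mod_cast hN
  have h := abs_trapezoid_sub_le
    (f := deriv psi) (F := psi) (v := fun x => τ / 2 * deriv psi x) hτ
    (fun x hx => trapezoid_step_deriv_psi hτ hx) hN' N
  have e : (N : ℝ) + N * τ = N * (1 + τ) := by ring
  rw [e] at h
  have h1 := deriv_psi_nonneg (x := N * (1 + τ)) (by positivity)
  have h2 : 0 ≤ τ / 2 * deriv psi (N * (1 + τ)) := by positivity
  rw [Real.norm_eq_abs]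
  linarith

theorem tendsto_seqD_sub {τ : ℝ} (hτ : 0 < τ) :
    Tendsto (fun N : ℕ => seqD τ N - latticeSum 2 τ N + (1 / τ) * Real.log N) atTop
      (𝓝 ((1 / τ ^ 2) * (Real.pi ^ 2 / 6) + (1 / τ) * (Real.log (1 + τ) - Real.log τ))) := by
  have hτ1 : 0 < 1 + τ := by linarith
  have hlim : ∀ {c : ℝ}, 0 < c →
      Tendsto (fun N : ℕ => psi (N * c) - Real.log (N * c)) atTop (𝓝 0) :=
    fun hc => tendsto_psi_sub_log.comp (tendsto_natCast_mul hc)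
  have hlim' : ∀ {c : ℝ}, 0 < c → Tendsto (fun N : ℕ => deriv psi (N * c)) atTop (𝓝 0) :=
    fun hc => tendsto_deriv_psi.comp (tendsto_natCast_mul hc)
  have hZ : Tendsto (fun N : ℕ => ∑ k ∈ Finset.Ico 1 N, 1 / (k : ℝ) ^ 2) atTop
      (𝓝 (Real.pi ^ 2 / 6)) := by
    refine hasSum_zeta_two.tendsto_sum_nat.congr' ?_
    filter_upwards [eventually_gt_atTop 0] with N hN
    rw [Finset.range_eq_Ico, Finset.sum_eq_sum_Ico_succ_bot hN]
    simp
  have h := (((((((tendsto_trapezoid_deriv_psi hτ).add ((hlim hτ1).sub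
    (hlim one_pos))).const_mul (1 / τ)).sub ((hlim' one_pos).const_mul (1 / 2))).sub
    ((hlim' hτ1).const_mul (1 / 2))).add ((hlim' hτ).const_mul (1 / 2))).sub
    ((hlim hτ).const_mul (1 / τ))).add (hZ.const_mul (1 / τ ^ 2))
  have h' := h.add_const ((1 / τ) * (Real.log (1 + τ) - Real.log τ))
  simp only [sub_zero, add_zero, mul_zero, zero_add] at h'
  refine h'.congr' ?_
  filter_upwards [eventually_ge_atTop 1] with N hN
  have hN' : (0 : ℝ) < N := by exact_mod_cast hN
  have e : (N : ℝ) + N * τ = N * (1 + τ) := by ring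
  rw [seqD, sum_deriv_psi_mul hτ, trapezoid_eq _ _ _ hN, e, mul_one,
    Real.log_mul hN'.ne' hτ1.ne', Real.log_mul hN'.ne' hτ.ne']
  field_simp
  ring

/-- With the weight `1 / τ²` the lattice sums for `τ` and `1/τ` cancel, and so do the two terms `(1
/ τ) log N`; only the limits from `tendsto_seqD_sub` survive. -/
theorem constD_inv {τ : ℝ} (hτ : 0 < τ) :
    constD τ - (1 / τ ^ 2) * constD τ⁻¹ =
      -(Real.pi ^ 2 / 6) * (1 - 1 / τ ^ 2) - (1 / τ) * Real.log τ := by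
  have hτ' : 0 < τ⁻¹ := inv_pos.2 hτ
  have h1 := (tendsto_seqD_sub hτ).sub ((tendsto_seqD_sub hτ').const_mul (1 / τ ^ 2))
  have h2 := (tendsto_seqD hτ).sub ((tendsto_seqD hτ').const_mul (1 / τ ^ 2))
  rw [tendsto_nhds_unique h2 (h1.congr fun N => ?_)]
  · have e : 1 + τ⁻¹ = (1 + τ) / τ := by
      field_simp
      ring
    rw [e, Real.log_div (by positivity) hτ.ne', Real.log_inv]
    field_simp
    ring
  · rw [latticeSum_inv 2 hτ]
    field_simp
    ring

theorem tendsto_sum_inv_sub_log :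
    Tendsto (fun N : ℕ => ∑ k ∈ Finset.Ico 1 N, 1 / (k : ℝ) - Real.log N) atTop
      (𝓝 Real.eulerMascheroniConstant) := by
  refine (tendsto_add_atTop_iff_nat 1).1 (Real.tendsto_harmonic_sub_log_add_one.congr fun n => ?_)
  have e : ((harmonic n : ℚ) : ℝ) = ∑ k ∈ Finset.Ico 1 (n + 1), 1 / (k : ℝ) := by
    induction n with
    | zero => simp
    | succ n ih =>
      rw [Finset.sum_Ico_succ_top (by omega), ← ih, harmonic_succ]
      push_cast
      ring
  rw [e]
  push_cast
  rfl

/-- Each `log Γ` is replaced by its Stirling main term. The linear terms cancel as `N(1 + τ) = N +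
Nτ`, and the three Stirling constants cancel against the `√(2π)` in the definition of `C(τ)`, so the
limit is `0`. -/
theorem tendsto_seqC_sub {τ : ℝ} (hτ : 0 < τ) :
    Tendsto (fun N : ℕ => seqC τ N + latticeSum 1 τ N
      + (1 / τ) * ∑ k ∈ Finset.Ico 1 N, 1 / (k : ℝ)
      - (1 / τ) * ((N * (1 + τ) - 1 / 2) * Real.log (N * (1 + τ))
        - (N - 1 / 2) * Real.log N - (N * τ - 1 / 2) * Real.log (N * τ))
      + 1 / 2 * Real.log N + 1 / 2 * Real.log (N * (1 + τ)) - 1 / 2 * Real.log (N * τ)) atTop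
      (𝓝 0) := by
  have hτ1 : 0 < 1 + τ := by linarith
  have hlim : ∀ {c : ℝ}, 0 < c →
      Tendsto (fun N : ℕ => psi (N * c) - Real.log (N * c)) atTop (𝓝 0) :=
    fun hc => tendsto_psi_sub_log.comp (tendsto_natCast_mul hc)
  have hlim' : ∀ {c : ℝ}, 0 < c → Tendsto (fun N : ℕ => stirlingRemainder (N * c)) atTop
      (𝓝 (1 / 2 * Real.log (2 * Real.pi))) :=
    fun hc => tendsto_stirlingRemainder.comp (tendsto_natCast_mul hc)
  have h := ((((((tendsto_trapezoid_psi hτ).add (((hlim' hτ1).sub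
    (hlim' one_pos)).sub (hlim' hτ))).const_mul (1 / τ)).sub ((hlim one_pos).const_mul (1 / 2))).sub
    ((hlim hτ1).const_mul (1 / 2))).add ((hlim hτ).const_mul (1 / 2))).add_const
    ((1 / τ) * (1 / 2 * Real.log (2 * Real.pi)))
  simp only [sub_self, sub_zero, add_zero, mul_zero, zero_add, zero_sub, mul_neg,
    neg_add_cancel] at h
  refine h.congr' ?_
  filter_upwards [eventually_ge_atTop 1] with N hN
  have e : (N : ℝ) + N * τ = N * (1 + τ) := by ring
  rw [seqC_eq hτ hN, sum_psi_mul hτ, trapezoid_eq _ _ _ hN, e, mul_one]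
  simp only [stirlingRemainder]
  field_simp
  ring

theorem constC_inv {τ : ℝ} (hτ : 0 < τ) :
    constC τ - (1 / τ) * constC τ⁻¹ =
      Real.eulerMascheroniConstant * (1 - 1 / τ) + 1 / 2 * (1 + 1 / τ) * Real.log τ := by
  have hτ' : 0 < τ⁻¹ := inv_pos.2 hτ
  -- The lattice sums cancel, but the harmonic sums are left with coefficient `1 / τ - 1`; adding
  -- `(1 - 1 / τ)` times the sequence tending to `γ` removes them.
  have h1 := (((tendsto_seqC_sub hτ).sub ((tendsto_seqC_sub hτ').const_mul (1 / τ))).add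
    (tendsto_sum_inv_sub_log.mul_const (1 - 1 / τ))).add_const (1 / 2 * (1 + 1 / τ) * Real.log τ)
  have h2 := (tendsto_seqC hτ).sub ((tendsto_seqC hτ').const_mul (1 / τ))
  simp only [sub_zero, mul_zero, zero_add] at h1
  refine tendsto_nhds_unique h2 (h1.congr' ?_)
  filter_upwards [eventually_ge_atTop 1] with N hN
  have hN' : (N : ℝ) ≠ 0 := by exact_mod_cast (by omega : N ≠ 0)
  have e : 1 + τ⁻¹ = (1 + τ) / τ := by
    field_simp
    ring
  have hτ1 : 1 + τ ≠ 0 := by positivity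
  rw [latticeSum_inv 1 hτ, e, Real.log_mul hN' (div_ne_zero hτ1 hτ.ne'), Real.log_mul hN' hτ'.ne',
    Real.log_mul hN' hτ1, Real.log_mul hN' hτ.ne', Real.log_div hτ1 hτ.ne', Real.log_inv]
  field_simp
  ring

/-! ### The reflection of the double gamma function -/

theorem constA_inv {τ : ℝ} (hτ : 0 < τ) :
    constA τ / τ - constA τ⁻¹ =
      1 / 2 * (1 - 1 / τ) * Real.log (2 * Real.pi) + 1 / 2 * (1 + 1 / τ) * Real.log τ := by
  have h := constC_inv hτ
  rw [constA, constA, Real.log_mul Real.two_pi_pos.ne' hτ.ne',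
    Real.log_mul Real.two_pi_pos.ne' (inv_pos.2 hτ).ne', Real.log_inv]
  have e : constC τ = (1 / τ) * constC τ⁻¹ + Real.eulerMascheroniConstant * (1 - 1 / τ)
    + 1 / 2 * (1 + 1 / τ) * Real.log τ := by linarith
  rw [e]
  field_simp
  ring

theorem constB_inv {τ : ℝ} (hτ : 0 < τ) :
    constB τ / τ ^ 2 - constB τ⁻¹ = -((1 / τ) * Real.log τ) := by
  have h := constD_inv hτ
  rw [constB, constB, Real.log_inv]
  have e : constD τ = (1 / τ ^ 2) * constD τ⁻¹ + (-(Real.pi ^ 2 / 6) * (1 - 1 / τ ^ 2)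
    - (1 / τ) * Real.log τ) := by linarith
  rw [e]
  field_simp
  ring

/-- The exponent of the reflection factor of the double gamma function. -/
def reflectionExponent (τ : ℝ) (z : ℂ) : ℂ :=
  z / 2 * (1 - 1 / τ) * (Real.log (2 * Real.pi) : ℝ)
    + (z * (1 + τ - z) / (2 * τ) - 1) * (Real.log τ : ℝ)

/-- Each factor depends only on `z / (kτ + l)`, which is unchanged when `z` and the lattice point
are both divided by `τ`. Reindexing by a bijection needs no convergence of the product. -/
theorem tprod_swap (τ : ℝ) (hτ : 0 < τ) (z : ℂ) :
    (∏' k : {k : ℕ × ℕ // k ≠ (0, 0)},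
      ((1 + z / (k.1.1 * τ + k.1.2)) *
        Complex.exp (-(z / (k.1.1 * τ + k.1.2)) + z ^ 2 / (2 * (k.1.1 * τ + k.1.2) ^ 2)))) =
    ∏' k : {k : ℕ × ℕ // k ≠ (0, 0)},
      ((1 + (τ : ℂ)⁻¹ * z / (k.1.1 * (τ⁻¹ : ℝ) + k.1.2)) *
        Complex.exp (-((τ : ℂ)⁻¹ * z / (k.1.1 * (τ⁻¹ : ℝ) + k.1.2))
          + ((τ : ℂ)⁻¹ * z) ^ 2 / (2 * (k.1.1 * (τ⁻¹ : ℝ) + k.1.2) ^ 2))) := by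
  have hτ' : (τ : ℂ) ≠ 0 := by exact_mod_cast hτ.ne'
  let e : {k : ℕ × ℕ // k ≠ (0, 0)} ≃ {k : ℕ × ℕ // k ≠ (0, 0)} :=
    (Equiv.prodComm ℕ ℕ).subtypeEquiv fun k => by
      simp only [ne_eq, Prod.ext_iff, Equiv.prodComm_apply, Prod.fst_swap, Prod.snd_swap]
      tauto
  rw [← e.tprod_eq]
  refine tprod_congr fun k => ?_
  have h1 : (e k).1.1 = k.1.2 := rfl
  have h2 : (e k).1.2 = k.1.1 := rfl
  have h3 : ((k.1.1 : ℂ) * (τ⁻¹ : ℝ) + k.1.2) = (τ : ℂ)⁻¹ * (k.1.2 * τ + k.1.1) := by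
    push_cast
    field_simp
    ring
  have h4 : (τ : ℂ)⁻¹ ≠ 0 := inv_ne_zero hτ'
  rw [h1, h2, h3, mul_div_mul_left _ _ h4, mul_pow, mul_pow, mul_left_comm (2 : ℂ),
    mul_div_mul_left _ _ (pow_ne_zero 2 h4)]

theorem doubleGamma_inv {τ : ℝ} (hτ : 0 < τ) (z : ℂ) :
    doubleGamma z τ =
      Complex.exp (reflectionExponent τ z) * doubleGamma ((τ : ℂ)⁻¹ * z) τ⁻¹ := by
  have hτ' : (τ : ℂ) ≠ 0 := by exact_mod_cast hτ.ne'
  rw [doubleGamma, doubleGamma, tprod_swap τ hτ, ← mul_assoc]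
  congr 1
  have hA : (constA τ : ℂ) = τ * (constA τ⁻¹ + (1 / 2 * (1 - 1 / τ) * (Real.log (2 * Real.pi) : ℝ)
      + 1 / 2 * (1 + 1 / τ) * (Real.log τ : ℝ))) := by
    have h : constA τ = τ * (constA τ⁻¹ + (1 / 2 * (1 - 1 / τ) * Real.log (2 * Real.pi)
        + 1 / 2 * (1 + 1 / τ) * Real.log τ)) := by
      rw [← constA_inv hτ]
      field_simp
      ring
    simpa using congrArg (fun x : ℝ => (x : ℂ)) h
  have hB : (constB τ : ℂ) = τ ^ 2 * (constB τ⁻¹ - 1 / τ * (Real.log τ : ℝ)) := by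
    have h : constB τ = τ ^ 2 * (constB τ⁻¹ - 1 / τ * Real.log τ) := by
      rw [sub_eq_add_neg, ← constB_inv hτ]
      field_simp
      ring
    simpa using congrArg (fun x : ℝ => (x : ℂ)) h
  -- The prefactors in front of the exponentials are `z / τ` and `z`; their ratio accounts for the
  -- `-1` multiplying `log τ` in the reflection exponent.
  have hexp : Complex.exp (-(Real.log τ : ℝ)) = (τ : ℂ)⁻¹ := by
    rw [Complex.exp_neg, ← Complex.ofReal_exp, Real.exp_log hτ]
  have e : reflectionExponent τ z + (constA τ⁻¹ * ((τ : ℂ)⁻¹ * z) / (τ⁻¹ : ℝ)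
      + constB τ⁻¹ * ((τ : ℂ)⁻¹ * z) ^ 2 / (2 * ((τ⁻¹ : ℝ) : ℂ) ^ 2)) =
      (constA τ * z / τ + constB τ * z ^ 2 / (2 * τ ^ 2)) + -(Real.log τ : ℝ) := by
    rw [reflectionExponent, hA, hB]
    push_cast
    field_simp
    ring
  have e2 : (τ : ℂ)⁻¹ * z / (τ⁻¹ : ℝ) = z := by
    push_cast
    field_simp
  rw [e2, mul_left_comm, ← Complex.exp_add, e, Complex.exp_add _ (-((Real.log τ : ℝ) : ℂ)), hexp]
  ring

/-! ### The reflection of the integrand -/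

theorem card_val_lt {m q : ℕ} (h : m ≤ q) :
    (Finset.univ.filter fun i : Fin q => i.val < m).card = m := by
  rw [Fin.card_filter_val_lt, min_eq_right h]

theorem sum_filter_add_sum_filter_le {q : ℕ} (m : ℕ) (g : Fin q → ℂ) :
    (∑ i : Fin q with i.val < m, g i) + (∑ i : Fin q with m ≤ i.val, g i) = ∑ i, g i := by
  simpa only [not_lt] using
    Finset.sum_filter_add_sum_filter_not Finset.univ (fun i : Fin q => i.val < m) g

theorem card_le_val {m q : ℕ} (h : m ≤ q) :
    ((Finset.univ.filter fun i : Fin q => m ≤ i.val).card : ℂ) = q - m := by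
  have := sum_filter_add_sum_filter_le (q := q) m fun _ => 1
  simp only [Finset.sum_const, nsmul_eq_mul, mul_one, card_val_lt h, Finset.card_univ,
    Fintype.card_fin] at this
  linear_combination this

/-- The exponent of the reflection factor of the kernel. -/
def kernelExponent (m n : ℕ) {p q : ℕ} (a : Fin p → ℂ) (α : Fin p → ℝ) (b : Fin q → ℂ)
    (β : Fin q → ℝ) (τ : ℝ) (s : ℂ) : ℂ :=
  (∑ i : Fin q with i.val < m, reflectionExponent τ (b i + β i * s)) +
    (∑ i : Fin p with i.val < n, reflectionExponent τ (1 + τ - a i - α i * s)) -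
    (∑ i : Fin q with m ≤ i.val, reflectionExponent τ (1 + τ - b i - β i * s)) -
    ∑ i : Fin p with n ≤ i.val, reflectionExponent τ (a i + α i * s)

theorem kernel_inv (m n : ℕ) {p q : ℕ} (a : Fin p → ℂ) (α : Fin p → ℝ) (b : Fin q → ℂ)
    (β : Fin q → ℝ) {τ : ℝ} (hτ : 0 < τ) (s : ℂ) :
    kernel m n a α b β τ s = Complex.exp (kernelExponent m n a α b β τ s) *
      kernel m n (fun i => (τ : ℂ)⁻¹ * a i) α (fun i => (τ : ℂ)⁻¹ * b i) β τ⁻¹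
        ((τ : ℂ)⁻¹ * s) := by
  have hτ' : (τ : ℂ) ≠ 0 := by exact_mod_cast hτ.ne'
  have h1 : ∀ x y : ℂ, (τ : ℂ)⁻¹ * x + y * ((τ : ℂ)⁻¹ * s) = (τ : ℂ)⁻¹ * (x + y * s) :=
    fun x y => by ring
  have h2 : ∀ x y : ℂ, 1 + ((τ⁻¹ : ℝ) : ℂ) - (τ : ℂ)⁻¹ * x - y * ((τ : ℂ)⁻¹ * s) =
      (τ : ℂ)⁻¹ * (1 + τ - x - y * s) := fun x y => by
    push_cast
    field_simp
    ring
  simp only [kernel, h1, h2, doubleGamma_inv hτ, Finset.prod_mul_distrib, kernelExponent,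
    Complex.exp_sub, Complex.exp_add, Complex.exp_sum, div_eq_mul_inv, mul_inv]
  ring

theorem kernelExponent_eq {m n p q : ℕ} (hm : m ≤ q) (hn : n ≤ p) (a : Fin p → ℂ)
    (α : Fin p → ℝ) (b : Fin q → ℂ) (β : Fin q → ℝ) {τ : ℝ} (hτ : 0 < τ) (s : ℂ) :
    kernelExponent m n a α b β τ s =
      ((τ : ℂ) - 1) / (2 * τ) * (deltaStar a b + (1 + τ) * ((m : ℂ) + n - q))
          * (Real.log (2 * Real.pi) : ℝ)
        + (1 / (2 * (τ : ℂ)) * ((1 + τ) * Dsum 1 m n a b - Dsum 2 m n a b) - Ncal m n p q)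
          * (Real.log τ : ℝ)
        + s * logB m n a α b β τ
        - s ^ 2 * (Delta 2 m n α β * (Real.log τ : ℝ) / (2 * τ)) := by
  have hτ' : (τ : ℂ) ≠ 0 := by exact_mod_cast hτ.ne'
  -- Apart from the constant `-log τ`, the `log τ` part of the exponent is a multiple of `z(1 + τ -
  -- z)`, invariant under `z ↦ 1 + τ - z`, so it sums to the signed sums. The `log 2π` part is
  -- linear and changes sign up to a constant, so it sums to `δ*` and `Δ*`, with `(1 + τ)(m + n -
  -- q)` left over.
  have e1 : ∀ x y : ℂ, reflectionExponent τ (x + y * s) =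
      (1 / 2 * (1 - 1 / τ) * (Real.log (2 * Real.pi) : ℝ)) * x
      + (s * (1 / 2 * (1 - 1 / τ) * (Real.log (2 * Real.pi) : ℝ))) * y
      + ((1 + τ) / (2 * τ) * (Real.log τ : ℝ)) * x ^ 1
      - ((Real.log τ : ℝ) / (2 * τ)) * x ^ 2
      + (s * ((1 + τ) / (2 * τ) * (Real.log τ : ℝ))) * y ^ 1
      - (s * ((Real.log τ : ℝ) / τ)) * (x * y)
      - (s ^ 2 * (Real.log τ : ℝ) / (2 * τ)) * y ^ 2 - (Real.log τ : ℝ) := fun x y => by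
    rw [reflectionExponent]
    field_simp
    ring
  have e2 : ∀ x y : ℂ, reflectionExponent τ (1 + τ - x - y * s) =
      (1 / 2 * (1 - 1 / τ) * (Real.log (2 * Real.pi) : ℝ)) * (1 + τ)
      - (1 / 2 * (1 - 1 / τ) * (Real.log (2 * Real.pi) : ℝ)) * x
      - (s * (1 / 2 * (1 - 1 / τ) * (Real.log (2 * Real.pi) : ℝ))) * y
      + ((1 + τ) / (2 * τ) * (Real.log τ : ℝ)) * x ^ 1
      - ((Real.log τ : ℝ) / (2 * τ)) * x ^ 2
      + (s * ((1 + τ) / (2 * τ) * (Real.log τ : ℝ))) * y ^ 1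
      - (s * ((Real.log τ : ℝ) / τ)) * (x * y)
      - (s ^ 2 * (Real.log τ : ℝ) / (2 * τ)) * y ^ 2 - (Real.log τ : ℝ) := fun x y => by
    rw [reflectionExponent]
    field_simp
    ring
  simp only [kernelExponent, e1, e2, Finset.sum_sub_distrib, Finset.sum_add_distrib,
    ← Finset.mul_sum, Finset.sum_const, nsmul_eq_mul, card_val_lt hm, card_val_lt hn,
    card_le_val hm, card_le_val hn]
  simp only [logB, expB₁, expB₂, deltaStar, DeltaStar, Dsum, Delta, PiSum, signedSum, Ncal,
    ← sum_filter_add_sum_filter_le m b, ← sum_filter_add_sum_filter_le n a,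
    ← sum_filter_add_sum_filter_le m fun i => (β i : ℂ),
    ← sum_filter_add_sum_filter_le n fun i => (α i : ℂ)]
  field_simp
  ring

theorem factorA_eq_exp (m n : ℕ) {p q : ℕ} (a : Fin p → ℂ) (b : Fin q → ℂ) {τ : ℝ} (hτ : 0 < τ) :
    factorA m n a b τ = Complex.exp
      (((τ : ℂ) - 1) / (2 * τ) * (deltaStar a b + (1 + τ) * ((m : ℂ) + n - q))
          * (Real.log (2 * Real.pi) : ℝ)
        + (1 / (2 * (τ : ℂ)) * ((1 + τ) * Dsum 1 m n a b - Dsum 2 m n a b) - Ncal m n p q)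
          * (Real.log τ : ℝ)) := by
  have h1 : ((2 * Real.pi : ℝ) : ℂ) ≠ 0 := by exact_mod_cast Real.two_pi_pos.ne'
  have h2 : (τ : ℂ) ≠ 0 := by exact_mod_cast hτ.ne'
  rw [factorA, Complex.cpow_def_of_ne_zero h1, Complex.cpow_def_of_ne_zero h2, ← Complex.exp_add,
    Complex.ofReal_log Real.two_pi_pos.le, Complex.ofReal_log hτ.le]
  congr 1
  ring

theorem factorA_ne_zero (m n : ℕ) {p q : ℕ} (a : Fin p → ℂ) (b : Fin q → ℂ) {τ : ℝ}
    (hτ : 0 < τ) : factorA m n a b τ ≠ 0 := by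
  rw [factorA_eq_exp m n a b hτ]
  exact Complex.exp_ne_zero _

theorem integrand_inv {m n p q : ℕ} (hm : m ≤ q) (hn : n ≤ p) (a : Fin p → ℂ)
    (α : Fin p → ℝ) (b : Fin q → ℂ) (β : Fin q → ℝ) {τ : ℝ} (hτ : 0 < τ) (ε ℓ s : ℂ) :
    integrand m n a α b β τ ε ℓ s = factorA m n a b τ *
      integrand m n (fun i => (τ : ℂ)⁻¹ * a i) α (fun i => (τ : ℂ)⁻¹ * b i) β τ⁻¹
        (ε - Delta 2 m n α β * Real.log τ / (2 * Real.pi)) (τ * (ℓ - logB m n a α b β τ))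
        ((τ : ℂ)⁻¹ * s) := by
  have hτ' : (τ : ℂ) ≠ 0 := by exact_mod_cast hτ.ne'
  have hpi : (Real.pi : ℂ) ≠ 0 := by exact_mod_cast Real.pi_ne_zero
  have h1 : (Real.pi : ℂ) * (ε - Delta 2 m n α β * Real.log τ / (2 * Real.pi)) *
      ((τ : ℂ)⁻¹ * s) ^ 2 / (τ⁻¹ : ℝ) =
      Real.pi * ε * s ^ 2 / τ + -(s ^ 2 * (Delta 2 m n α β * (Real.log τ : ℝ) / (2 * τ))) := by
    push_cast
    field_simp
    ring
  have h2 : -((τ : ℂ)⁻¹ * s) * (τ * (ℓ - logB m n a α b β τ)) =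
      -s * ℓ + s * logB m n a α b β τ := by
    field_simp
    ring
  rw [integrand, integrand, kernel_inv m n a α b β hτ, kernelExponent_eq hm hn a α b β hτ,
    factorA_eq_exp m n a b hτ, h1, h2, sub_eq_add_neg, Complex.exp_add, Complex.exp_add,
    Complex.exp_add (Real.pi * ε * s ^ 2 / τ), Complex.exp_add (-s * ℓ)]
  ring

/-- The substitution `s ↦ s / τ` is made on the curve, not in the parameter, so it is a pointwise
identity whose factor `τ` comes from the derivative. It holds also where the curve is not
differentiable. -/
theorem integrand_mul_deriv_inv {m n p q : ℕ} (hm : m ≤ q) (hn : n ≤ p) (a : Fin p → ℂ)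
    (α : Fin p → ℝ) (b : Fin q → ℂ) (β : Fin q → ℝ) {τ : ℝ} (hτ : 0 < τ) (ε ℓ : ℂ)
    (γ : ℝ → ℂ) (t : ℝ) :
    integrand m n a α b β τ ε ℓ (γ t) * deriv γ t = factorA m n a b τ * τ *
      (integrand m n (fun i => (τ : ℂ)⁻¹ * a i) α (fun i => (τ : ℂ)⁻¹ * b i) β τ⁻¹
        (ε - Delta 2 m n α β * Real.log τ / (2 * Real.pi)) (τ * (ℓ - logB m n a α b β τ))
        ((τ : ℂ)⁻¹ * γ t) * deriv (fun t => (τ : ℂ)⁻¹ * γ t) t) := by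
  have hτ' : (τ : ℂ) ≠ 0 := by exact_mod_cast hτ.ne'
  rw [integrand_inv hm hn a α b β hτ, deriv_const_mul_field]
  field_simp

/-! ### Dilation of contours -/

theorem joinedIn_dilate {r : ℝ} (hr : 0 < r) {γ : ℝ → ℂ} {s w : ℂ}
    (h : JoinedIn (Set.range γ)ᶜ s w) :
    JoinedIn (Set.range fun t => (r : ℂ) * γ t)ᶜ (r * s) (r * w) := by
  have hr' : (r : ℂ) ≠ 0 := by exact_mod_cast hr.ne'
  refine (h.map (f := fun z => (r : ℂ) * z) (by fun_prop)).mono ?_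
  rintro _ ⟨z, hz, rfl⟩ ⟨t, ht⟩
  exact hz ⟨t, mul_left_cancel₀ hr' ht⟩

theorem LeftOf.dilate {r : ℝ} (hr : 0 < r) {γ : ℝ → ℂ} {s : ℂ} (h : LeftOf γ s) :
    LeftOf (fun t => (r : ℂ) * γ t) (r * s) := by
  have hr' : (r : ℂ) ≠ 0 := by exact_mod_cast hr.ne'
  -- The base point `-R` of the dilated picture is the image of `-R / r`.
  filter_upwards [(tendsto_id.const_mul_atTop (inv_pos.2 hr)).eventually h] with R hR
  convert joinedIn_dilate hr hR using 1
  simp [hr']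

theorem RightOf.dilate {r : ℝ} (hr : 0 < r) {γ : ℝ → ℂ} {s : ℂ} (h : RightOf γ s) :
    RightOf (fun t => (r : ℂ) * γ t) (r * s) := by
  have hr' : (r : ℂ) ≠ 0 := by exact_mod_cast hr.ne'
  filter_upwards [(tendsto_id.const_mul_atTop (inv_pos.2 hr)).eventually h] with R hR
  convert joinedIn_dilate hr hR using 1
  simp [hr']

theorem ContourKind.HasEnds.dilate {r : ℝ} (hr : 0 < r) {γ : ℝ → ℂ} {κ : ContourKind}
    (h : κ.HasEnds γ) : (κ.dilate r).HasEnds fun t => (r : ℂ) * γ t := by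
  have habs : ∀ {h : ℝ}, (∀ t, |(γ t).im| ≤ h) → ∀ t, |r * (γ t).im| ≤ r * h := fun H t => by
    rw [abs_mul, abs_of_pos hr]
    exact mul_le_mul_of_nonneg_left (H t) hr.le
  cases κ with
  | vertical c =>
    obtain ⟨h1, h2, h3, h4⟩ := h
    simp only [ContourKind.dilate, ContourKind.HasEnds, Complex.re_ofReal_mul,
      Complex.im_ofReal_mul]
    exact ⟨h1.const_mul r, h2.const_mul_atBot hr, h3.const_mul r, h4.const_mul_atTop hr⟩
  | sector θ₁ θ₂ =>
    obtain ⟨h1, ⟨s₁, h2⟩, s₂, h3⟩ := h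
    refine ⟨h1, ⟨r * s₁, h2.mono ?_⟩, r * s₂, h3.mono ?_⟩
    all_goals
      rintro t ⟨ρ, hρ, e⟩
      refine ⟨r * ρ, by positivity, ?_⟩
      simp only [e]
      push_cast
      ring
  | leftLoop φ₁ φ₂ =>
    obtain ⟨⟨h1, h2⟩, ⟨h, hh⟩, h3, h4, h5, h6⟩ := h
    simp only [ContourKind.dilate, ContourKind.HasEnds, Complex.re_ofReal_mul,
      Complex.im_ofReal_mul]
    exact ⟨⟨mul_neg_of_pos_of_neg hr h1, mul_pos hr h2⟩, ⟨r * h, habs hh⟩,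
      h3.const_mul_atBot hr, h4.const_mul r, h5.const_mul_atBot hr, h6.const_mul r⟩
  | rightLoop φ₁ φ₂ =>
    obtain ⟨⟨h1, h2⟩, ⟨h, hh⟩, h3, h4, h5, h6⟩ := h
    simp only [ContourKind.dilate, ContourKind.HasEnds, Complex.re_ofReal_mul,
      Complex.im_ofReal_mul]
    exact ⟨⟨mul_neg_of_pos_of_neg hr h1, mul_pos hr h2⟩, ⟨r * h, habs hh⟩,
      h3.const_mul_atTop hr, h4.const_mul r, h5.const_mul_atTop hr, h6.const_mul r⟩

theorem IsContour.dilate_inv {m n p q : ℕ} {a : Fin p → ℂ} {α : Fin p → ℝ} {b : Fin q → ℂ}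
    {β : Fin q → ℝ} {τ : ℝ} (hτ : 0 < τ) {κ : ContourKind} {γ : ℝ → ℂ}
    (hγ : IsContour m n a α b β τ κ γ) :
    IsContour m n (fun i => (τ : ℂ)⁻¹ * a i) α (fun i => (τ : ℂ)⁻¹ * b i) β τ⁻¹
      (κ.dilate τ⁻¹) (fun t => (τ : ℂ)⁻¹ * γ t) := by
  have hτ' : (τ : ℂ) ≠ 0 := by exact_mod_cast hτ.ne'
  have hr : 0 < τ⁻¹ := inv_pos.2 hτ
  have hinv : (τ : ℂ)⁻¹ ≠ 0 := inv_ne_zero hτ'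
  have hco : Tendsto (fun z : ℂ => (τ : ℂ)⁻¹ * z) (cocompact ℂ) (cocompact ℂ) :=
    (Homeomorph.mulLeft₀ _ hinv).isClosedEmbedding.tendsto_cocompact
  refine ⟨fun x y h => hγ.injective (mul_left_cancel₀ hinv h), ?_, ?_, hco.comp hγ.tendsto_atBot,
    hco.comp hγ.tendsto_atTop, ?_, ?_, ?_⟩
  · exact (lipschitzWith_smul (τ : ℂ)⁻¹).locallyLipschitz.comp hγ.locallyLipschitz
  · obtain ⟨S, hS, h⟩ := hγ.piecewise
    exact ⟨S, hS, fun t ht => contDiffAt_const.mul (h t ht)⟩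
  · simpa only [Complex.ofReal_inv] using hγ.ends.dilate hr
  · rintro s ⟨i, hi, k, l, rfl⟩
    -- The indices are exchanged because `a / τ + k / τ + l = (a + lτ + k) / τ`.
    have h := (hγ.left _ ⟨i, hi, l, k, rfl⟩).dilate hr
    simp only [Complex.ofReal_inv] at h
    convert h using 1
    push_cast
    field_simp
    ring
  · rintro s ⟨i, hi, k, l, hk, hl, rfl⟩
    have h := (hγ.right _ ⟨i, hi, l, k, hl, hk, rfl⟩).dilate hr
    simp only [Complex.ofReal_inv] at h
    convert h using 1
    push_cast
    field_simp
    ring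

/-- The principal logarithm has to invert `exp` twice, at `log z - w` and at `τ` times it; the two
hypotheses place these imaginary parts in the principal strip. -/
theorem log_div_exp_cpow {z w : ℂ} (hz : z ≠ 0) {τ : ℝ}
    (h1 : z.arg - w.im ∈ Set.Ioc (-Real.pi) Real.pi)
    (h2 : τ * (z.arg - w.im) ∈ Set.Ioc (-Real.pi) Real.pi) :
    Complex.log ((z / Complex.exp w) ^ (τ : ℂ)) = τ * (Complex.log z - w) := by
  have e : z / Complex.exp w = Complex.exp (Complex.log z - w) := by
    rw [Complex.exp_sub, Complex.exp_log hz]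
  have him : (Complex.log z - w).im = z.arg - w.im := by rw [Complex.sub_im, Complex.log_im]
  have hlog : Complex.log (Complex.exp (Complex.log z - w)) = Complex.log z - w :=
    Complex.log_exp (him ▸ h1.1) (him ▸ h1.2)
  have him2 : (τ * (Complex.log z - w)).im = τ * (z.arg - w.im) := by
    rw [Complex.im_ofReal_mul, him]
  rw [e, Complex.cpow_def_of_ne_zero (Complex.exp_ne_zero _), hlog, mul_comm]
  exact Complex.log_exp (him2 ▸ h2.1) (him2 ▸ h2.2)

end FoxBarnes

end

/-! ### The transformation formula. -/

open FoxBarnes in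
theorem proposition3 (m n p q : ℕ) (hm : m ≤ q) (hn : n ≤ p)
    (a : Fin p → ℂ) (α : Fin p → ℝ) (hα : ∀ i, 0 < α i)
    (b : Fin q → ℂ) (β : Fin q → ℝ) (hβ : ∀ i, 0 < β i)
    (τ : ℝ) (hτ : 0 < τ) (ε : ℂ)
    (κ : ContourKind) (γ : ℝ → ℂ) (hγ : IsContour m n a α b β τ κ γ) :
    -- the dilated contour is one for the transformed parameters, of the dilated kind
    IsContour m n (fun i => (τ : ℂ)⁻¹ * a i) α (fun i => (τ : ℂ)⁻¹ * b i) β τ⁻¹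
        (κ.dilate τ⁻¹) (fun t => (τ : ℂ)⁻¹ * γ t) ∧
    -- the two integrals converge together
    (∀ ℓ : ℂ,
      Converges m n a α b β τ ε γ ℓ ↔
        Converges m n (fun i => (τ : ℂ)⁻¹ * a i) α (fun i => (τ : ℂ)⁻¹ * b i) β τ⁻¹
          (ε - Delta 2 m n α β * Real.log τ / (2 * Real.pi))
          (fun t => (τ : ℂ)⁻¹ * γ t) (τ * (ℓ - logB m n a α b β τ))) ∧
    -- the identity on the Riemann surface of the logarithm, with `ℓ = log z`
    (∀ ℓ : ℂ,
      foxBarnesI m n a α b β τ ε γ ℓ =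
        factorA m n a b τ * τ *
          foxBarnesI m n (fun i => (τ : ℂ)⁻¹ * a i) α (fun i => (τ : ℂ)⁻¹ * b i) β τ⁻¹
            (ε - Delta 2 m n α β * Real.log τ / (2 * Real.pi))
            (fun t => (τ : ℂ)⁻¹ * γ t) (τ * (ℓ - logB m n a α b β τ))) ∧
    -- the identity with principal powers of `z`, where the arguments stay in `(-π, π]`
    (∀ z : ℂ, z ≠ 0 →
      z.arg - (logB m n a α b β τ).im ∈ Set.Ioc (-Real.pi) Real.pi →
      τ * (z.arg - (logB m n a α b β τ).im) ∈ Set.Ioc (-Real.pi) Real.pi →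
      foxBarnesI m n a α b β τ ε γ (Complex.log z) =
        factorA m n a b τ * τ *
          foxBarnesI m n (fun i => (τ : ℂ)⁻¹ * a i) α (fun i => (τ : ℂ)⁻¹ * b i) β τ⁻¹
            (ε - Delta 2 m n α β * Real.log τ / (2 * Real.pi))
            (fun t => (τ : ℂ)⁻¹ * γ t)
            (Complex.log ((z / factorB m n a α b β τ) ^ (τ : ℂ)))) := by
  have hid : ∀ ℓ : ℂ, foxBarnesI m n a α b β τ ε γ ℓ = factorA m n a b τ * τ *
      foxBarnesI m n (fun i => (τ : ℂ)⁻¹ * a i) α (fun i => (τ : ℂ)⁻¹ * b i) β τ⁻¹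
        (ε - Delta 2 m n α β * Real.log τ / (2 * Real.pi))
        (fun t => (τ : ℂ)⁻¹ * γ t) (τ * (ℓ - logB m n a α b β τ)) := fun ℓ => by
    simp only [foxBarnesI, integrand_mul_deriv_inv hm hn a α b β hτ ε ℓ γ]
    -- Constants leave the integral without any integrability assumption, so the identity also holds
    -- for divergent integrals, where both sides are `0`.
    rw [integral_const_mul]
    ring
  refine ⟨hγ.dilate_inv hτ, fun ℓ => ?_, hid, fun z hz h1 h2 => ?_⟩
  · simp only [Converges, integrand_mul_deriv_inv hm hn a α b β hτ ε ℓ γ]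
    refine integrable_const_mul_iff (IsUnit.mk0 _ (mul_ne_zero (factorA_ne_zero m n a b hτ) ?_)) _
    exact_mod_cast hτ.ne'
  · rw [hid, ← exp_logB m n a α b β hτ, log_div_exp_cpow hz h1 h2]
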